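/- Conventions. A category is *Barr exact* if it is regular (it has finite limits, coequalizers of kernel pairs, and pullback-stable regular epimorphisms) and every internal equivalence relation in it is a kernel pair. A category with pullbacks is *Bourn protomodular* if, for every morphism $v:E\to B$, the pullback functor $v^*:\mathrm{Pt}(B)\to\mathrm{Pt}(E)$ between categories of points (split epimorphisms with a chosen splitting) reflects isomorphisms. A category is *semi-abelian* if it is pointed, Barr exact and Bourn protomodular, and has finite coproducts. A category $\mathscr{A}$ is *ideally exact* if it is Barr exact and Bourn protomodular, has finite coproducts, and the unique morphism $0\to 1$ from its initial to its terminal object is a regular epimorphism. A monad $T=(T,\eta,\mu)$ is *cartesian* if $T$ preserves pullbacks and all naturality squares of $\eta$ and $\mu$ are pullbacks. A monad $T$ on a category with finite coproducts is *essentially nullary* if, for every object $X$, the morphism $[T(!_X),\eta_X]:T(0)+X\to T(X)$ is a strong epimorphism, where $!_X:0\to X$. **Theorem 3.3.** Let $\mathscr{A}$ be an ideally exact category. Then: (a) $\mathscr{A}$ has finite colimits; (b) there exists a monadic functor $\mathscr{A}\to\mathscr{X}$ with $\mathscr{X}$ semi-abelian, such that the underlying functor of the corresponding monad on $\mathscr{X}$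 preserves regular epimorphisms and kernel pairs, and this monad is cartesian and essentially nullary. Namely, one may take $\mathscr{X}=(\mathscr{A}\downarrow 0)$ and the pullback functor $\mathscr{A}\simeq(\mathscr{A}\downarrow 1)\to(\mathscr{A}\downarrow 0)$, $A\mapsto(0\times A,\mathrm{proj}_1)$, along $0\to 1$, with its left adjoint $(D,\delta)\mapsto D$. -/

import Mathlib

open CategoryTheory CategoryTheory.Limits

universe v u

noncomputable section

namespace CategoryTheory

/-- A Barr exact category: a regular category (finite limits, coequalizers of kernel pairs, and
pullback-stable regular epimorphisms) in which every internal equivalence relation is effective,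
i.e. is the kernel pair of some morphism. -/
class BarrExact (C : Type u) [Category.{v} C] : Prop extends Regular C where
  exists_isKernelPair : ∀ {R X : C} (p₁ p₂ : R ⟶ X), IsEquivalenceRelation p₁ p₂ →
    ∃ (Y : C) (f : X ⟶ Y), IsKernelPair f p₁ p₂

/-- Bourn protomodularity: for every `v : E ⟶ B`, the pullback functor `v^* : Pt(B) ⥤ Pt(E)` between
categories of points (split epimorphisms with a chosen section) reflects isomorphisms.
A morphism of points `(D, p, s) ⟶ (D', p', s')` over `B` is a morphism `f : D ⟶ D'` with
`f ≫ p' = p` and `s ≫ f = s'`; its image under `v^*` is the morphism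
`E ×_B D ⟶ E ×_B D'` induced by `f`. -/
class BournProtomodular (C : Type u) [Category.{v} C] [HasPullbacks C] : Prop where
  isIso_of_isIso_pullback_map : ∀ {E B D D' : C} (v : E ⟶ B)
    (p : D ⟶ B) (s : B ⟶ D) (p' : D' ⟶ B) (s' : B ⟶ D') (_ : s ≫ p = 𝟙 B) (_ : s' ≫ p' = 𝟙 B)
    (f : D ⟶ D') (hp : f ≫ p' = p) (_ : s ≫ f = s'),
    IsIso (pullback.map v p v p' (𝟙 E) f (𝟙 B) (by simp) (by simp [hp])) → IsIso f

/-- A semi-abelian category: pointed (it has a zero object), Barr exact and Bourn protomodular, with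
finite coproducts. -/
class SemiAbelian (C : Type u) [Category.{v} C] : Prop extends
    BarrExact C, BournProtomodular C where
  hasFiniteCoproducts : HasFiniteCoproducts C
  hasZeroObject : HasZeroObject C

attribute [instance] SemiAbelian.hasFiniteCoproducts SemiAbelian.hasZeroObject

/-- An ideally exact category: Barr exact and Bourn protomodular, with finite coproducts, such that
the unique morphism `0 ⟶ 1` is a regular epimorphism. -/
class IdeallyExact (C : Type u) [Category.{v} C] : Prop extends
    BarrExact C, BournProtomodular C where
  hasFiniteCoproducts : HasFiniteCoproducts C
  isRegularEpi_initial_to_terminal : IsRegularEpi (initial.to (⊤_ C))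

attribute [instance] IdeallyExact.hasFiniteCoproducts

instance Over.hasFiniteCoproducts_of_base (C : Type u) [Category.{v} C] [HasFiniteCoproducts C]
    (B : C) : HasFiniteCoproducts (Over B) where
  out _ := inferInstance

/-- A functor preserves regular epimorphisms. -/
def Functor.PreservesRegularEpis {C : Type*} [Category* C] {D : Type*} [Category* D]
    (F : C ⥤ D) : Prop :=
  ∀ {X Y : C} (f : X ⟶ Y), IsRegularEpi f → IsRegularEpi (F.map f)

/-- A functor preserves kernel pairs. -/
def Functor.PreservesKernelPairs {C : Type*} [Category* C] {D : Type*} [Category* D]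
    (F : C ⥤ D) : Prop :=
  ∀ {R X Y : C} (f : X ⟶ Y) (a b : R ⟶ X),
    IsKernelPair f a b → IsKernelPair (F.map f) (F.map a) (F.map b)

/-- A monad is cartesian if its underlying functor preserves pullbacks and all naturality squares
of its unit and of its multiplication are pullbacks. -/
structure Monad.IsCartesian {C : Type u} [Category.{v} C] (T : Monad C) : Prop where
  preservesPullbacks : PreservesLimitsOfShape WalkingCospan T.toFunctor
  unit : NatTrans.Equifibered T.η
  mul : NatTrans.Equifibered T.μ

/-- A monad `T` on a category with finite coproducts is essentially nullary if the morphism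
`[T(0 ⟶ X), η_X] : T(0) + X ⟶ T(X)` is a strong epimorphism for every object `X`. -/
def Monad.IsEssentiallyNullary {C : Type u} [Category.{v} C] [HasFiniteCoproducts C]
    (T : Monad C) : Prop :=
  ∀ X : C, StrongEpi (coprod.desc (T.map (initial.to X)) (T.η.app X))

section PullbackAlong

variable (C : Type u) [Category.{v} C] [HasFiniteLimits C] [HasInitial C]

/-- The pullback functor along `0 ⟶ 1`, as the composite `C ≌ Over 1 ⥤ Over 0`; it sends `X` to
`0 ×_1 X` with its projection to `0`. -/
def pullbackToInitial : C ⥤ Over (⊥_ C) :=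
  (Over.equivalenceOfIsTerminal (terminalIsTerminal (C := C))).inverse ⋙
    Over.pullback (initial.to (⊤_ C))

/-- The left adjoint of the pullback functor along `0 ⟶ 1`: the composite of postcomposition
`Over 0 ⥤ Over 1` with the equivalence `Over 1 ≌ C`; it sends `(D, δ)` to `D`. -/
def mapFromInitial : Over (⊥_ C) ⥤ C :=
  Over.map (initial.to (⊤_ C)) ⋙
    (Over.equivalenceOfIsTerminal (terminalIsTerminal (C := C))).functor

/-- The adjunction associated to `0 ⟶ 1`. -/
def initialToTerminalAdj : mapFromInitial C ⊣ pullbackToInitial C :=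
  (Over.mapPullbackAdj (initial.to (⊤_ C))).comp
    (Over.equivalenceOfIsTerminal (terminalIsTerminal (C := C))).toAdjunction

end PullbackAlong

end CategoryTheory

end

/-! Everything rests on one observation: the counit of the adjunction is the projection `0 × X ⟶ X`,
a base change of `0 ⟶ 1`. Hence its naturality squares are pullbacks and its components are regular
epimorphisms. The squares make the monad cartesian and let the pullback functor preserve regular
epimorphisms; the regular epimorphisms make that functor conservative. Protomodularity gives the
Mal'tsev property (`ReflexiveRelation.isEquivalenceRelation`), so by exactness reflexive
coequalizers exist, and functors preserving pullbacks and regular epimorphisms preserve them. Finite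
colimits and, by the reflexive monadicity theorem, monadicity follow. The slice over `0` inherits
exactness and protomodularity from the base, and is pointed. -/

namespace CategoryTheory

attribute [local simp] pullback.lift_fst pullback.lift_snd pullback.lift_fst_assoc
  pullback.lift_snd_assoc prod.lift_fst prod.lift_snd prod.lift_fst_assoc prod.lift_snd_assoc
  coprod.inl_desc coprod.inr_desc coprod.inl_desc_assoc coprod.inr_desc_assoc

/-! ### Protomodular categories are Mal'tsev -/

section Protomodular

variable {C : Type u} [Category.{v} C] [HasPullbacks C] [BournProtomodular C]

lemma BournProtomodular.isIso_of_isPullback {E B D D' P P' : C} {v : E ⟶ B}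
    {p : D ⟶ B} {s : B ⟶ D} {p' : D' ⟶ B} {s' : B ⟶ D'} (hs : s ≫ p = 𝟙 B) (hs' : s' ≫ p' = 𝟙 B)
    {f : D ⟶ D'} (hp : f ≫ p' = p) (hsf : s ≫ f = s')
    {a : P ⟶ E} {b : P ⟶ D} {a' : P' ⟶ E} {b' : P' ⟶ D'}
    (h : IsPullback a b v p) (h' : IsPullback a' b' v p') (g : P ⟶ P') [IsIso g]
    (ga : g ≫ a' = a) (gb : g ≫ b' = b ≫ f) : IsIso f := by
  refine BournProtomodular.isIso_of_isIso_pullback_map v p s p' s' hs hs' f hp hsf ?_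
  have : pullback.map v p v p' (𝟙 E) f (𝟙 B) (by simp) (by simp [hp]) =
      h.isoPullback.inv ≫ g ≫ h'.isoPullback.hom := by
    rw [Iso.eq_inv_comp]
    ext <;> simp [pullback.map, ga, gb]
  rw [this]
  infer_instance

/-- In a protomodular category, the section of a point and the projection to it from any of its
pullbacks are jointly extremal-epimorphic. -/
lemma BournProtomodular.isIso_of_mono_of_fac {E B D P M : C} {v : E ⟶ B}
    {p : D ⟶ B} {s : B ⟶ D} (hs : s ≫ p = 𝟙 B) {a : P ⟶ E} {b : P ⟶ D} (h : IsPullback a b v p)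
    (m : M ⟶ D) [Mono m] (b₀ : P ⟶ M) (hb : b₀ ≫ m = b) (s₀ : B ⟶ M) (hs₀ : s₀ ≫ m = s) :
    IsIso m := by
  -- Since `b` factors through `m`, the points `M` and `D` have the same pullback along `v`.
  have h' : IsPullback a b₀ v (m ≫ p) := by
    refine ⟨⟨by rw [reassoc_of% hb, h.w]⟩, ⟨PullbackCone.IsLimit.mk _
      (fun t ↦ h.lift t.fst (t.snd ≫ m) (by simpa using t.condition)) (by simp) (fun t ↦ ?_)
      (fun t l h₁ h₂ ↦ h.hom_ext (by simpa using h₁) ?_)⟩⟩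
    · rw [← cancel_mono m, Category.assoc, hb, h.lift_snd]
    · rw [h.lift_snd, ← h₂, Category.assoc, hb]
  exact isIso_of_isPullback (s := s₀) (by rw [reassoc_of% hs₀, hs]) hs rfl hs₀ h' h (𝟙 P)
    (by simp) (by simp [hb])

variable [HasBinaryProducts C]

/-- In a protomodular category, a reflexive relation is Euclidean: `x R y` and `z R y` imply
`x R z`. -/
lemma ReflexiveRelation.exists_euclidean {R X : C} {r₁ r₂ : R ⟶ X} (h : ReflexiveRelation r₁ r₂)
    {T : C} (a b : T ⟶ R) (hab : a ≫ r₂ = b ≫ r₂) :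
    ∃ c : T ⟶ R, c ≫ r₁ = a ≫ r₁ ∧ c ≫ r₂ = b ≫ r₁ := by
  have hj := h.toJointlyMono₂.right_cancellation
  have : Mono (prod.lift r₁ r₂) := ⟨fun f g w ↦ hj f g
    (by simpa using w =≫ prod.fst) (by simpa using w =≫ prod.snd)⟩
  let k : pullback r₂ r₂ ⟶ X ⨯ X :=
    prod.lift (pullback.fst r₂ r₂ ≫ r₁) (pullback.snd r₂ r₂ ≫ r₁)
  -- View pairs `(x R y, z R y)` as a point over `R` by the second projection, split by the
  -- diagonal. Its pullback along reflexivity consists of the pairs `(x R y, y R y)`.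
  have hP : IsPullback r₂ (pullback.lift (𝟙 R) (r₂ ≫ h.r) (by simp)) h.r (pullback.snd r₂ r₂) := by
    refine ⟨⟨by simp⟩, ⟨PullbackCone.IsLimit.mk _ (fun t ↦ t.snd ≫ pullback.fst r₂ r₂)
      (fun t ↦ ?_) (fun t ↦ ?_) (fun t l _ h₂ ↦ by simp [← h₂, Category.assoc])⟩⟩
    · simp [pullback.condition, ← reassoc_of% t.condition]
    · ext
      · simp
      · simp [pullback.condition_assoc, ← reassoc_of% t.condition, ← t.condition]
  -- The subobject of pairs with `x R z` contains the pairs `(x R y, y R y)` and the diagonal, so it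
  -- is everything.
  have hiso : IsIso (pullback.snd (prod.lift r₁ r₂) k) :=
    BournProtomodular.isIso_of_mono_of_fac
      (s := pullback.lift (𝟙 R) (𝟙 R) rfl) (by simp) hP _
      (pullback.lift (𝟙 R) (pullback.lift (𝟙 R) (r₂ ≫ h.r) (by simp)) (by ext <;> simp [k]))
      (by simp) (pullback.lift (r₁ ≫ h.r) (pullback.lift (𝟙 R) (𝟙 R) rfl) (by ext <;> simp [k]))
      (by simp)
  refine ⟨pullback.lift a b hab ≫ inv (pullback.snd (prod.lift r₁ r₂) k) ≫ pullback.fst _ _, ?_⟩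
  have key := pullback.lift a b hab ≫= inv (pullback.snd (prod.lift r₁ r₂) k) ≫=
    (pullback.condition (f := prod.lift r₁ r₂) (g := k))
  rw [IsIso.inv_hom_id_assoc] at key
  exact ⟨by simpa [k] using key =≫ prod.fst, by simpa [k] using key =≫ prod.snd⟩

/-- Protomodular categories are Mal'tsev: every reflexive relation is an equivalence relation. -/
lemma ReflexiveRelation.isEquivalenceRelation {R X : C} {r₁ r₂ : R ⟶ X}
    (h : ReflexiveRelation r₁ r₂) : IsEquivalenceRelation r₁ r₂ := by
  -- Symmetry: `y R y` and `x R y` give `y R x`. Transitivity then follows by reversing the second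
  -- relation.
  obtain ⟨σ, hσ₁, hσ₂⟩ := h.exists_euclidean (r₂ ≫ h.r) (𝟙 R) (by simp)
  obtain ⟨τ, hτ₁, hτ₂⟩ := h.exists_euclidean (pullback.fst r₂ r₁) (pullback.snd r₂ r₁ ≫ σ)
    (by simpa [hσ₂] using pullback.condition)
  exact ⟨⟨{
    __ := h
    s := σ
    symmetry₁ := by simpa using hσ₁
    symmetry₂ := by simpa using hσ₂
    c := pullback.cone r₂ r₁
    isLimit := pullback.isLimit r₂ r₁
    t := τ
    transitivity₁ := hτ₁
    transitivity₂ := by simpa [hσ₁] using hτ₂ }⟩⟩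

end Protomodular

/-! ### Reflexive coequalizers in exact protomodular categories -/

section Exact

variable {C : Type u} [Category.{v} C]

/-- If `f` and `g` become the kernel pair of `q` after factoring out an epimorphism, then a regular
epimorphism `q` is their coequalizer. -/
lemma IsKernelPair.nonempty_isColimit_of_epi {X Y Q R : C} {q : Y ⟶ Q} [IsRegularEpi q]
    {r₁ r₂ : R ⟶ Y} (h : IsKernelPair q r₁ r₂) {f g : X ⟶ Y} (e : X ⟶ R) [Epi e]
    (hf : e ≫ r₁ = f) (hg : e ≫ r₂ = g) (w : f ≫ q = g ≫ q) :
    Nonempty (IsColimit (Cofork.ofπ q w)) := by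
  subst hf hg
  exact ⟨isCoequalizerEpiComp h.toCoequalizer' e⟩

/-- Equivalence relations in a Barr exact category are kernel pairs of regular epimorphisms. -/
lemma BarrExact.exists_isRegularEpi_isKernelPair [BarrExact C] {R X : C} {r₁ r₂ : R ⟶ X}
    (h : IsEquivalenceRelation r₁ r₂) :
    ∃ (Q : C) (q : X ⟶ Q), IsRegularEpi q ∧ IsKernelPair q r₁ r₂ := by
  obtain ⟨Y, f, hf⟩ := BarrExact.exists_isKernelPair r₁ r₂ h
  refine ⟨_, (Regular.strongEpiMonoFactorisation f).e, inferInstance, ?_⟩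
  rw [← (Regular.strongEpiMonoFactorisation f).fac] at hf
  exact hf.cancel_right_of_mono

variable [BarrExact C] [BournProtomodular C]

/-- The image of `(f, g)` in `Y ⨯ Y` is a reflexive relation, hence an effective equivalence
relation. -/
lemma exists_isKernelPair_of_isReflexivePair {X Y : C} (f g : X ⟶ Y) [IsReflexivePair f g] :
    ∃ (Q R : C) (q : Y ⟶ Q) (r₁ r₂ : R ⟶ Y) (e : X ⟶ R), IsRegularEpi q ∧ IsKernelPair q r₁ r₂ ∧
      IsRegularEpi e ∧ e ≫ r₁ = f ∧ e ≫ r₂ = g := by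
  obtain ⟨t, htf, htg⟩ := IsReflexivePair.common_section f g
  let φ := Regular.strongEpiMonoFactorisation (prod.lift f g)
  have h₁ : φ.e ≫ φ.m ≫ prod.fst = f := by rw [φ.fac_assoc]; simp
  have h₂ : φ.e ≫ φ.m ≫ prod.snd = g := by rw [φ.fac_assoc]; simp
  let ρ : ReflexiveRelation (φ.m ≫ prod.fst) (φ.m ≫ prod.snd) :=
    { right_cancellation := fun _ a b ha hb ↦ by
        rw [← cancel_mono φ.m]
        ext
        · simpa using ha
        · simpa using hb
      r := t ≫ φ.e
      reflexivity₁ := by rw [Category.assoc, h₁, htf]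
      reflexivity₂ := by rw [Category.assoc, h₂, htg] }
  obtain ⟨Q, q, hq, hk⟩ := BarrExact.exists_isRegularEpi_isKernelPair ρ.isEquivalenceRelation
  exact ⟨Q, φ.I, q, _, _, φ.e, hq, hk, inferInstanceAs (IsRegularEpi
    (Regular.strongEpiMonoFactorisation (prod.lift f g)).e), h₁, h₂⟩

instance hasReflexiveCoequalizers_of_barrExact : HasReflexiveCoequalizers C where
  has_coeq _ _ f g _ := by
    obtain ⟨Q, R, q, r₁, r₂, e, _, hk, _, hf, hg⟩ := exists_isKernelPair_of_isReflexivePair f g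
    obtain ⟨hc⟩ := hk.nonempty_isColimit_of_epi e hf hg (by simp [← hf, ← hg, hk.w])
    exact ⟨⟨_, hc⟩⟩

lemma preservesColimit_parallelPair_of_isReflexivePair {D : Type*} [Category* D] (G : C ⥤ D)
    (hG : G.PreservesRegularEpis) [PreservesLimitsOfShape WalkingCospan G]
    {X Y : C} (f g : X ⟶ Y) [IsReflexivePair f g] : PreservesColimit (parallelPair f g) G := by
  obtain ⟨Q, R, q, r₁, r₂, e, _, hk, _, hf, hg⟩ := exists_isKernelPair_of_isReflexivePair f g
  obtain ⟨hc⟩ := hk.nonempty_isColimit_of_epi e hf hg (by simp [← hf, ← hg, hk.w])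
  have := hG q inferInstance
  have := hG e inferInstance
  obtain ⟨hc'⟩ := IsKernelPair.nonempty_isColimit_of_epi (hk.map G) (G.map e)
    (f := G.map f) (g := G.map g) (by simp [← hf]) (by simp [← hg])
    (by simp only [← G.map_comp, ← hf, ← hg, Category.assoc, hk.w])
  exact preservesColimit_of_preserves_colimit_cocone hc
    ((isColimitMapCoconeCoforkEquiv G _).symm hc')

lemma hasCoequalizers_of_hasReflexiveCoequalizers (C : Type u) [Category.{v} C]
    [HasReflexiveCoequalizers C] [HasBinaryCoproducts C] : HasCoequalizers C := by
  refine @hasCoequalizers_of_hasColimit_parallelPair _ _ @fun X Y f g ↦ ?_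
  -- Adjoining a copy of `Y` makes the pair reflexive without changing which morphisms coequalize
  -- it.
  have : IsReflexivePair (coprod.desc f (𝟙 Y)) (coprod.desc g (𝟙 Y)) :=
    .mk' coprod.inr (by simp) (by simp)
  let f' := coprod.desc f (𝟙 Y)
  let g' := coprod.desc g (𝟙 Y)
  have w : f ≫ coequalizer.π f' g' = g ≫ coequalizer.π f' g' := by
    simpa [f', g'] using coprod.inl ≫= coequalizer.condition f' g'
  have hs (s : Cofork f g) : f' ≫ s.π = g' ≫ s.π := by ext <;> simp [f', g', s.condition]
  exact ⟨⟨_, Cofork.IsColimit.mk (Cofork.ofπ (coequalizer.π f' g') w)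
    (fun s ↦ coequalizer.desc s.π (hs s)) (fun s ↦ coequalizer.π_desc s.π (hs s))
    (fun s m hm ↦ coequalizer.hom_ext (hm.trans (coequalizer.π_desc s.π (hs s)).symm))⟩⟩

end Exact

lemma Adjunction.preservesRegularEpis {C : Type*} [Category* C] {D : Type*} [Category* D]
    {F : C ⥤ D} {G : D ⥤ C} (adj : F ⊣ G) : F.PreservesRegularEpis := fun f hf ↦ by
  have := adj.leftAdjoint_preservesColimits
  let r := IsRegularEpi.getStruct f
  exact ⟨⟨⟨F.obj r.W, F.map r.left, F.map r.right, by simp only [← F.map_comp, r.w],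
    isColimitCoforkMapOfIsColimit F r.w r.isColimit⟩⟩⟩

/-! ### Exactness and protomodularity of slices -/

namespace Over

variable {C : Type u} [Category.{v} C] {B : C}

lemma isPullback_left_iff {P X Y Z : Over B} {a : P ⟶ X} {b : P ⟶ Y} {f : X ⟶ Z} {g : Y ⟶ Z} :
    IsPullback a.left b.left f.left g.left ↔ IsPullback a b f g :=
  ⟨fun h ↦ IsPullback.of_map_of_faithful (Over.forget B) h, fun h ↦ h.map (Over.forget B)⟩

lemma isRegularEpi_of_left [HasPullbacks C] {X Y : Over B} (f : X ⟶ Y) [IsRegularEpi f.left] :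
    IsRegularEpi f := by
  have h := IsKernelPair.of_hasPullback f
  have : IsRegularEpi ((Over.forget B).map f) := ‹_›
  have h' := h.map (Over.forget B)
  exact ⟨⟨⟨_, _, _, h.w, isColimitOfIsColimitCoforkMap (Over.forget B) h.w
    (IsKernelPair.toCoequalizer' h')⟩⟩⟩

lemma isRegularEpi_left_iff [HasPullbacks C] [HasBinaryProducts C] {X Y : Over B} (f : X ⟶ Y) :
    IsRegularEpi f.left ↔ IsRegularEpi f :=
  ⟨fun _ ↦ isRegularEpi_of_left f, (Over.forgetAdjStar B).preservesRegularEpis f⟩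

lemma isEquivalenceRelation_left {R X : Over B} {r₁ r₂ : R ⟶ X}
    (h : IsEquivalenceRelation r₁ r₂) : IsEquivalenceRelation r₁.left r₂.left := by
  obtain ⟨e⟩ := h.nonempty_equivalenceRelation
  have : JointlyMono₂ ((Over.forget B).map r₁) ((Over.forget B).map r₂) := ⟨fun T
      (f g : T ⟶ R.left) (h₁ : f ≫ r₁.left = g ≫ r₁.left) (h₂ : f ≫ r₂.left = g ≫ r₂.left) ↦ by
    have w : f ≫ R.hom = g ≫ R.hom := by
      simpa using h₁ =≫ X.hom
    exact congr_arg (·.left) (e.toJointlyMono₂.right_cancellation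
      (Over.homMk f : Over.mk (f ≫ R.hom) ⟶ R) (Over.homMk g w.symm) (by ext; exact h₁)
      (by ext; exact h₂))⟩
  exact ⟨⟨{ e.toReflexiveRelation.map (Over.forget B), e.toSymmetricRelation.map (Over.forget B),
    e.toTransitiveRelation.map (Over.forget B) with }⟩⟩

instance barrExact [BarrExact C] : BarrExact (Over B) where
  hasCoequalizer_of_isKernelPair {X Y Z f g₁ g₂} h := by
    have := Regular.hasCoequalizer_of_isKernelPair (h.map (Over.forget B))
    have : HasColimit (parallelPair ((parallelPair g₁ g₂ ⋙ forget B).map .left)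
      ((parallelPair g₁ g₂ ⋙ forget B).map .right)) := this
    have : HasColimit (parallelPair g₁ g₂ ⋙ Over.forget B) :=
      hasColimit_of_iso (diagramIsoParallelPair _)
    exact Over.hasColimit_of_hasColimit_comp_forget _
  regularEpiIsStableUnderBaseChange := ⟨fun sq hf ↦ by
    have := Regular.regularEpiIsStableUnderBaseChange (C := C)
    exact (isRegularEpi_left_iff _).1 (this.of_isPullback (isPullback_left_iff.2 sq)
      ((isRegularEpi_left_iff _).2 hf))⟩
  exists_isKernelPair {R X} r₁ r₂ h := by
    obtain ⟨Q, q, _, hq⟩ :=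
      BarrExact.exists_isRegularEpi_isKernelPair (isEquivalenceRelation_left h)
    -- `X.hom` coequalizes the relation, so it descends to the quotient and places it over `B`.
    obtain ⟨t, ht⟩ := IsRegularEpi.exists_of_isKernelPair q hq X.hom (by simp)
    exact ⟨Over.mk t, Over.homMk q ht, isPullback_left_iff.1 hq⟩

instance bournProtomodular [HasPullbacks C] [BournProtomodular C] :
    BournProtomodular (Over B) where
  isIso_of_isIso_pullback_map v p s p' s' hs hs' f hp hsf h := by
    let g := pullback.map v p v p' (𝟙 _) f (𝟙 _) (by simp) (by simp [hp])
    have : IsIso g := h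
    have : IsIso g.left := inferInstanceAs (IsIso ((Over.forget B).map g))
    have : IsIso ((Over.forget B).map f) := BournProtomodular.isIso_of_isPullback
      (p := p.left) (s := s.left) (p' := p'.left) (s' := s'.left)
      (congr_arg (·.left) hs) (congr_arg (·.left) hs') (congr_arg (·.left) hp)
      (congr_arg (·.left) hsf)
      (isPullback_left_iff.2 (IsPullback.of_hasPullback v p))
      (isPullback_left_iff.2 (IsPullback.of_hasPullback v p'))
      g.left
      (congr_arg (·.left) (show g ≫ pullback.fst v p' = pullback.fst v p by
        simp [g, pullback.map, pullback.lift_fst]))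
      (congr_arg (·.left) (show g ≫ pullback.snd v p' = pullback.snd v p ≫ f by
        simp [g, pullback.map, pullback.lift_snd]))
    exact isIso_of_reflects_iso f (Over.forget B)

lemma hasZeroObject_of_isInitial (hB : IsInitial B) : HasZeroObject (Over B) :=
  ⟨⟨Over.mk (𝟙 B), ⟨fun Y ↦ ⟨⟨⟨Over.homMk (hB.to Y.left) (hB.hom_ext _ _)⟩,
    fun f ↦ by ext; exact hB.hom_ext _ _⟩⟩, fun Y ↦ ⟨⟨⟨Over.mkIdTerminal.from Y⟩,
    fun _ ↦ Over.mkIdTerminal.hom_ext _ _⟩⟩⟩⟩⟩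

lemma semiAbelian_of_isInitial [BarrExact C] [BournProtomodular C] [HasFiniteCoproducts C]
    (hB : IsInitial B) : SemiAbelian (Over B) where
  exists_isKernelPair := BarrExact.exists_isKernelPair
  isIso_of_isIso_pullback_map := BournProtomodular.isIso_of_isIso_pullback_map
  hasFiniteCoproducts := inferInstance
  hasZeroObject := hasZeroObject_of_isInitial hB

end Over

/-! ### Adjunctions with cartesian counit -/

namespace Adjunction

variable {C : Type*} [Category* C] {D : Type*} [Category* D] {F : C ⥤ D} {G : D ⥤ C}
  (adj : F ⊣ G)

lemma unit_equifibered [ReflectsLimitsOfShape WalkingCospan F]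
    (h : NatTrans.Equifibered adj.counit) : NatTrans.Equifibered adj.unit := fun X Y f ↦ by
  -- By the triangle identity, pasting the image under `F` of the unit square with the counit square
  -- at `F.map f` gives a trivial pullback.
  refine IsPullback.of_map F (adj.unit.naturality f) (.of_bot ?_ ?_ (h (F.map f)))
  · change IsPullback (F.map f) (F.map (adj.unit.app X) ≫ adj.counit.app (F.obj X))
      (F.map (adj.unit.app Y) ≫ adj.counit.app (F.obj Y)) (F.map f)
    simpa using IsPullback.of_vert_isIso ⟨by simp⟩
  · exact (F.map_comp _ _).symm.trans
      ((congr_arg F.map (adj.unit.naturality f)).trans (F.map_comp _ _))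

lemma preservesRegularEpis_of_counit_equifibered [Regular D] (h : NatTrans.Equifibered adj.counit)
    (hF : ∀ {X Y : C} (f : X ⟶ Y), IsRegularEpi (F.map f) → IsRegularEpi f) :
    G.PreservesRegularEpis := fun f hf ↦
  hF _ (Regular.regularEpiIsStableUnderBaseChange.of_isPullback (h f).flip hf)

lemma reflectsIsomorphisms_of_isRegularEpi_counit (hε : ∀ Y, IsRegularEpi (adj.counit.app Y)) :
    G.ReflectsIsomorphisms where
  reflects {X Y} f _ := by
    have (Y : D) : Epi (adj.counit.app Y) := inferInstance
    have := adj.faithful_R_of_epi_counit_app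
    have : Mono f := G.mono_of_mono_map inferInstance
    have : StrongEpi (adj.counit.app X ≫ f) := by
      rw [← Functor.id_map f, ← adj.counit.naturality f]
      dsimp
      infer_instance
    have := strongEpi_of_strongEpi (adj.counit.app X) f
    exact isIso_of_mono_of_strongEpi f

end Adjunction

lemma Adjunction.toMonad_isCartesian {C : Type u} [Category.{v} C] {D : Type*} [Category* D]
    {F : C ⥤ D} {G : D ⥤ C} (adj : F ⊣ G) [PreservesLimitsOfShape WalkingCospan F]
    [ReflectsLimitsOfShape WalkingCospan F] (h : NatTrans.Equifibered adj.counit) :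
    adj.toMonad.IsCartesian := by
  have := adj.rightAdjoint_preservesLimits
  exact {
    preservesPullbacks := inferInstanceAs (PreservesLimitsOfShape WalkingCospan (F ⋙ G))
    unit := adj.unit_equifibered h
    mul := fun X Y f ↦ by
      rw [Adjunction.toMonad_μ]
      exact (h (F.map f)).map G }

/-- A cartesian monad on a pointed protomodular category is essentially nullary. -/
lemma Monad.IsCartesian.isEssentiallyNullary {C : Type u} [Category.{v} C] [HasFiniteLimits C]
    [BournProtomodular C] [HasFiniteCoproducts C] [HasZeroObject C] {T : Monad C}
    (hT : T.IsCartesian) : T.IsEssentiallyNullary := fun X ↦ by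
  rw [← extremalEpi_iff_strongEpi_of_hasPullbacks]
  refine ExtremalEpi.mk_of_hasEqualizers _ fun Z p i hi _ ↦ ?_
  have h0 : IsZero (⊥_ C) :=
    (isZero_zero C).of_iso (initialIsInitial.uniqueUpToIso (isZero_zero C).isInitial)
  -- The unit square at `X ⟶ 0` presents `η_X` as the pullback of `η_0` along `T X ⟶ T 0`, a point
  -- split by `T 0 ⟶ T X`.
  exact BournProtomodular.isIso_of_mono_of_fac
    (s := T.map (initial.to X)) (by rw [← T.map_comp, h0.eq_of_src (_ ≫ _) (𝟙 _), T.map_id])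
    (hT.unit (h0.from_ X)) i
    (coprod.inr ≫ p) (by rw [Category.assoc, hi, coprod.inr_desc])
    (coprod.inl ≫ p) (by rw [Category.assoc, hi, coprod.inl_desc])

/-! ### The adjunction along `0 ⟶ 1` -/

section PullbackAlong

variable (C : Type u) [Category.{v} C] [HasFiniteLimits C] [HasInitial C]

lemma initialToTerminalAdj_isPullback (X : C) :
    IsPullback ((initialToTerminalAdj C).counit.app X) ((pullbackToInitial C).obj X).hom
      (terminalIsTerminal.from X) (initial.to (⊤_ C)) := by
  have h : (initialToTerminalAdj C).counit.app X =
      ((Over.mapPullbackAdj (initial.to (⊤_ C))).counit.app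
        (Over.mk (terminalIsTerminal.from X))).left :=
    (Adjunction.comp_counit_app (Over.mapPullbackAdj (initial.to (⊤_ C)))
      (Over.equivalenceOfIsTerminal terminalIsTerminal).toAdjunction X).trans (Category.comp_id _)
  rw [h, Over.mapPullbackAdj_counit_app]
  exact IsPullback.of_hasPullback (terminalIsTerminal.from X) (initial.to (⊤_ C))

lemma initialToTerminalAdj_counit_equifibered :
    NatTrans.Equifibered (initialToTerminalAdj C).counit := fun X Y f ↦ by
  -- Pullback cancellation: the squares of `X` and of `Y` over `0 ⟶ 1` are both pullbacks.
  refine .of_right ?_ ((initialToTerminalAdj C).counit.naturality f)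
    (initialToTerminalAdj_isPullback C Y).flip
  have h₁ : (pullbackToInitial C ⋙ mapFromInitial C).map f ≫ ((pullbackToInitial C).obj Y).hom =
      ((pullbackToInitial C).obj X).hom := Over.w ((pullbackToInitial C).map f)
  have h₂ : (𝟭 C).map f ≫ terminalIsTerminal.from Y = terminalIsTerminal.from X :=
    terminalIsTerminal.hom_ext _ _
  exact (h₁.symm ▸ h₂.symm ▸ (initialToTerminalAdj_isPullback C X).flip :)

instance : PreservesLimitsOfShape WalkingCospan (mapFromInitial C) :=
  inferInstanceAs (PreservesLimitsOfShape WalkingCospan (Over.forget (⊥_ C)))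

instance : ReflectsLimitsOfShape WalkingCospan (mapFromInitial C) :=
  inferInstanceAs (ReflectsLimitsOfShape WalkingCospan (Over.forget (⊥_ C)))

end PullbackAlong

end CategoryTheory

theorem theorem3p3 (A : Type u) [Category.{v} A] [IdeallyExact A] :
    -- `A` has finite colimits
    HasFiniteColimits A ∧
    -- the pullback functor `A ⥤ (A ↓ 0)` along `0 ⟶ 1` has semi-abelian codomain,
    SemiAbelian (Over (⊥_ A)) ∧
    -- is monadic,
    (Monad.comparison (initialToTerminalAdj A)).IsEquivalence ∧
    -- and the corresponding monad has the stated properties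
    (initialToTerminalAdj A).toMonad.toFunctor.PreservesRegularEpis ∧
    (initialToTerminalAdj A).toMonad.toFunctor.PreservesKernelPairs ∧
    (initialToTerminalAdj A).toMonad.IsCartesian ∧
    (initialToTerminalAdj A).toMonad.IsEssentiallyNullary := by
  let adj := initialToTerminalAdj A
  have hε : NatTrans.Equifibered adj.counit := initialToTerminalAdj_counit_equifibered A
  have hG : (pullbackToInitial A).PreservesRegularEpis :=
    adj.preservesRegularEpis_of_counit_equifibered hε fun f hf ↦ (Over.isRegularEpi_left_iff f).1 hf
  have hT : adj.toMonad.IsCartesian := adj.toMonad_isCartesian hε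
  have := Over.semiAbelian_of_isInitial (initialIsInitial (C := A))
  have : HasCoequalizers A := hasCoequalizers_of_hasReflexiveCoequalizers A
  have : (pullbackToInitial A).ReflectsIsomorphisms :=
    adj.reflectsIsomorphisms_of_isRegularEpi_counit fun X ↦ by
      have : IsRegularEpi (initial.to (⊤_ A)) := IdeallyExact.isRegularEpi_initial_to_terminal
      exact Regular.regularEpiIsStableUnderBaseChange.of_isPullback
        (initialToTerminalAdj_isPullback A X).flip this
  have : Monad.PreservesColimitOfIsReflexivePair (pullbackToInitial A) := by
    have := adj.rightAdjoint_preservesLimits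
    exact ⟨fun _ _ f g _ ↦ preservesColimit_parallelPair_of_isReflexivePair _ hG f g⟩
  refine ⟨hasFiniteColimits_of_hasCoequalizers_and_finite_coproducts, inferInstance,
    (Monad.monadicOfHasPreservesReflexiveCoequalizersOfReflectsIsomorphisms adj).eqv,
    fun f hf ↦ hG _ (adj.preservesRegularEpis f hf), fun f a b h ↦ ?_, hT, hT.isEssentiallyNullary⟩
  have := hT.preservesPullbacks
  exact h.map _
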